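/- Let $R$ be a commutative Artinian ring in which every ideal is principal, and let $M$ be any $R$-module (not assumed finitely generated). Call a module Hopfian if each of its surjective endomorphisms is an isomorphism, co-Hopfian if each of its injective endomorphisms is an isomorphism, and bi-Hopfian if it is both Hopfian and co-Hopfian. Let $E(M)$ denote an injective envelope of $M$, that is, an injective $R$-module containing $M$ such that every nonzero submodule of $E(M)$ meets $M$ nontrivially. 1. $M$ is bi-Hopfian if and only if $M$ is finitely generated. 2. $M$ is bi-Hopfian if and only if $E(M)$ is bi-Hopfian. -/

import Mathlib

universe u v w

section HopfConditions

variable (R : Type*) [Ring R] (M : Type*) [AddCommGroup M] [Module R M]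

/-- A module is Hopfian if each of its surjective endomorphisms is an isomorphism. -/
def IsHopfianModule : Prop :=
  ∀ f : M →ₗ[R] M, Function.Surjective f → Function.Bijective f

/-- A module is co-Hopfian if each of its injective endomorphisms is an isomorphism. -/
def IsCoHopfianModule : Prop :=
  ∀ f : M →ₗ[R] M, Function.Injective f → Function.Bijective f

/-- A module is bi-Hopfian if it is both Hopfian and co-Hopfian. -/
def IsBiHopfianModule : Prop :=
  IsHopfianModule R M ∧ IsCoHopfianModule R M

end HopfConditions

section InjectiveEnvelopes

variable {R : Type u} [Ring R] {M : Type v} [AddCommGroup M] [Module R M]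
  {E : Type w} [AddCommGroup E] [Module R E]

/-- A monomorphism `i : M → E` is essential if every nonzero submodule of `E` meets the image
of `i` nontrivially. -/
def IsEssentialMono (i : M →ₗ[R] E) : Prop :=
  Function.Injective i ∧ ∀ N : Submodule R E, N ≠ ⊥ → N ⊓ LinearMap.range i ≠ ⊥

/-- `i : M → E` exhibits `E` as an injective envelope of `M`: the module `E` is injective and `i`
is an essential monomorphism. Mathlib's `Module.Injective` tests `E` against modules in the universe
of `E`; the smallness of `R` makes this the same as injectivity against all modules. -/
structure IsInjectiveEnvelope [Small.{w} R] (i : M →ₗ[R] E) : Prop where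
  injective : Module.Injective R E
  essential : IsEssentialMono i

end InjectiveEnvelopes

open Submodule

section Hopf

variable {R : Type*} [CommRing R] {M N : Type*} [AddCommGroup M] [Module R M]
  [AddCommGroup N] [Module R N]

/-! Finitely generated modules over `R` have finite length, hence are bi-Hopfian. Conversely, a
product of maximal ideals `(p)` vanishes, so `M` is finitely generated once each `M[p]` is
(`finite_of_torsionBy_fg`). Filter `M[p]` by the `M[p] ∩ p ^ k M`. If some quotient of consecutive
terms is infinite-dimensional over `R / (p)`, self-injectivity of `R / (p ^ (k + 1))` makes an
infinite free module over that ring a retract of `M` (`exists_infinite_retract`), and a shift shows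
that `M` is not co-Hopfian. An essential extension has no new `p`-torsion, so `M` and `E` are
finitely generated together. -/

theorem IsCoHopfianModule.of_retract (h : IsCoHopfianModule R M) (σ : N →ₗ[R] M) (ρ : M →ₗ[R] N)
    (hρσ : ∀ x, ρ (σ x) = x) : IsCoHopfianModule R N := by
  intro s hs
  refine ⟨hs, fun y => ?_⟩
  -- Extend `s` by the identity on the complement `ker ρ`.
  let f : M →ₗ[R] M := LinearMap.id - σ ∘ₗ ρ + σ ∘ₗ s ∘ₗ ρ
  have hf : ∀ m, f m = m - σ (ρ m) + σ (s (ρ m)) := fun m => rfl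
  have hρf : ∀ m, ρ (f m) = s (ρ m) := fun m => by simp [hf, hρσ]
  have hinj : Function.Injective f := by
    rw [injective_iff_map_eq_zero]
    intro m hm
    have h0 : ρ m = 0 := by
      have := hρf m
      rw [hm, map_zero] at this
      exact hs (by rw [map_zero, ← this])
    simpa [hf, h0] using hm
  obtain ⟨m, hm⟩ := (h f hinj).2 (σ y)
  exact ⟨ρ m, by rw [← hρf, hm, hρσ]⟩

theorem isBiHopfianModule_of_finite [IsArtinianRing R] [Module.Finite R M] :
    IsBiHopfianModule R M :=
  ⟨fun f hf => ⟨IsNoetherian.injective_of_surjective_endomorphism f hf, hf⟩,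
    fun f hf => IsArtinian.bijective_of_injective_endomorphism f hf⟩

end Hopf

theorem not_isCoHopfianModule_finsupp {R A ι : Type*} [CommRing R] [Ring A] [Nontrivial A]
    [Module R A] [Infinite ι] : ¬ IsCoHopfianModule R (ι →₀ A) := by
  intro h
  obtain ⟨e⟩ : Nonempty (Option ι ≃ ι) := by
    rw [← Cardinal.eq]
    simp [Cardinal.mk_option, Cardinal.add_one_of_aleph0_le, Cardinal.aleph0_le_mk]
  have he : Function.Injective (e ∘ some) := e.injective.comp (Option.some_injective _)
  obtain ⟨f, hf⟩ := (h (Finsupp.lmapDomain A R (e ∘ some))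
    (Finsupp.mapDomain_injective he)).2 (Finsupp.single (e none) 1)
  have h1 := DFunLike.congr_fun hf (e none)
  rw [Finsupp.lmapDomain_apply, Finsupp.mapDomain_of_notMem_range _ _ (by simp),
    Finsupp.single_eq_same] at h1
  exact zero_ne_one h1

theorem Finsupp.exists_eq_smul_of_dvd {A ι : Type*} [CommRing A] (a : A) (f : ι →₀ A)
    (h : ∀ i, a ∣ f i) : ∃ c : ι →₀ A, f = a • c := by
  classical
  choose c hc using h
  -- Zero quotients off the support of `f` keep `c` finitely supported.
  refine ⟨Finsupp.onFinset f.support (fun i => if f i = 0 then 0 else c i) (by simp +contextual), ?_⟩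
  ext i
  by_cases hi : f i = 0
  · simp [hi]
  · simpa [hi] using hc i

section ChainRing

variable {A : Type*} [CommRing A] {π : A} {k : ℕ}

theorem exists_eq_pow_mul_unit (hu : ∀ u, ¬ π ∣ u → IsUnit u) (hk1 : π ^ (k + 1) = 0) (y : A) :
    ∃ j ≤ k + 1, ∃ u, IsUnit u ∧ y = π ^ j * u := by
  by_cases h0 : π ^ (k + 1) ∣ y
  · refine ⟨k + 1, le_rfl, 1, isUnit_one, ?_⟩
    rw [hk1, zero_dvd_iff] at h0
    rw [h0, hk1, zero_mul]
  · obtain ⟨u, hy, hj⟩ := FiniteMultiplicity.exists_eq_pow_mul_and_not_dvd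
      (⟨k, h0⟩ : FiniteMultiplicity π y)
    refine ⟨multiplicity π y, ?_, u, hu u hj, hy⟩
    by_contra! hlt
    exact h0 ((pow_dvd_pow π hlt.le).trans ⟨u, hy⟩)

theorem pow_dvd_of_pow_mul_eq_zero (hu : ∀ u, ¬ π ∣ u → IsUnit u) (hk : π ^ k ≠ 0)
    (hk1 : π ^ (k + 1) = 0) {i : ℕ} {y : A} (h : π ^ i * y = 0) : π ^ (k + 1 - i) ∣ y := by
  obtain ⟨j, -, u, hu', rfl⟩ := exists_eq_pow_mul_unit hu hk1 y
  rw [← mul_assoc, ← pow_add, hu'.mul_left_eq_zero] at h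
  have : k + 1 ≤ i + j := by
    by_contra! hlt
    exact hk (pow_eq_zero_of_le (by omega) h)
  exact Dvd.dvd.mul_right (pow_dvd_pow π (by omega)) u

/-- Every ideal is some `(π ^ j)`. The image of `π ^ j` is killed by `π ^ (k + 1 - j)`, hence
divisible by `π ^ j`, and the quotient defines the extension. -/
theorem baer_finsupp [IsPrincipalIdealRing A] (hu : ∀ u, ¬ π ∣ u → IsUnit u) (hk : π ^ k ≠ 0)
    (hk1 : π ^ (k + 1) = 0) (ι : Type*) : Module.Baer A (ι →₀ A) := by
  intro I g
  obtain ⟨a, ha⟩ := (IsPrincipalIdealRing.principal I).principal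
  obtain ⟨j, hj, u, hu', rfl⟩ := exists_eq_pow_mul_unit hu hk1 a
  have hI : I = Ideal.span {π ^ j} := by
    rw [ha]; exact Ideal.span_singleton_mul_right_unit hu' _
  subst hI
  have hmem : π ^ j ∈ Ideal.span {π ^ j} := Ideal.mem_span_singleton_self _
  have hy : π ^ (k + 1 - j) • g ⟨π ^ j, hmem⟩ = 0 := by
    rw [← map_smul]
    convert map_zero g
    refine Subtype.ext ?_
    change π ^ (k + 1 - j) * π ^ j = 0
    rw [← pow_add, Nat.sub_add_cancel hj, hk1]
  obtain ⟨c, hc⟩ := Finsupp.exists_eq_smul_of_dvd (π ^ j) (g ⟨π ^ j, hmem⟩) fun i => by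
    have := pow_dvd_of_pow_mul_eq_zero hu hk hk1 (DFunLike.congr_fun hy i)
    rwa [Nat.sub_sub_self hj] at this
  refine ⟨LinearMap.toSpanSingleton A _ c, fun x hx => ?_⟩
  obtain ⟨r, rfl⟩ := Ideal.mem_span_singleton'.1 hx
  have : (⟨r * π ^ j, hx⟩ : Ideal.span {π ^ j}) = r • ⟨π ^ j, hmem⟩ := rfl
  rw [this, map_smul, hc, LinearMap.toSpanSingleton_apply, mul_smul]

/-- The last nonzero `π ^ m • f` is killed by `π`, so it is a relation with coefficients in `(π ^
k)`. -/
theorem linearIndependent_of_pow_smul (hu : ∀ u, ¬ π ∣ u → IsUnit u) (hk : π ^ k ≠ 0)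
    (hk1 : π ^ (k + 1) = 0) {ι X : Type*} [AddCommGroup X] [Module A X] (x : ι → X)
    (h : ∀ c : ι →₀ A, Finsupp.linearCombination A x (π ^ k • c) = 0 → π ^ k • c = 0) :
    LinearIndependent A x := by
  classical
  rw [linearIndependent_iff]
  intro f hf
  by_contra hf0
  have hex : ∃ m, π ^ m • f = 0 := ⟨k + 1, by rw [hk1, zero_smul]⟩
  obtain ⟨m, hm, hmin⟩ : ∃ m, π ^ (m + 1) • f = 0 ∧ π ^ m • f ≠ 0 := by
    have h1 := Nat.find_spec hex
    rcases hn : Nat.find hex with _ | m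
    · rw [hn, pow_zero, one_smul] at h1
      exact (hf0 h1).elim
    · exact ⟨m, by rwa [hn] at h1, Nat.find_min hex (by omega)⟩
  obtain ⟨c, hc⟩ := Finsupp.exists_eq_smul_of_dvd (π ^ k) (π ^ m • f) fun i =>
    pow_dvd_of_pow_mul_eq_zero (i := 1) hu hk hk1 (by
      have := DFunLike.congr_fun hm i
      simpa [pow_succ', mul_assoc] using this)
  refine hmin ?_
  rw [hc]
  refine h c ?_
  rw [← hc, map_smul, hf, smul_zero]

theorem exists_retraction_of_linearIndependent [IsPrincipalIdealRing A]
    (hu : ∀ u, ¬ π ∣ u → IsUnit u) (hk : π ^ k ≠ 0)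
    (hk1 : π ^ (k + 1) = 0) {ι X : Type*} [AddCommGroup X] [Module A X] {x : ι → X}
    (hx : LinearIndependent A x) :
    ∃ r : X →ₗ[A] (ι →₀ A), ∀ i, r (x i) = Finsupp.single i 1 := by
  obtain ⟨r, hr⟩ := (baer_finsupp hu hk hk1 ι).extension_property
    (Finsupp.linearCombination A x) hx LinearMap.id
  refine ⟨r, fun i => ?_⟩
  have := LinearMap.congr_fun hr (Finsupp.single i 1)
  simpa using this

end ChainRing

section Torsion

variable {R : Type*} [CommRing R] {M : Type*} [AddCommGroup M] [Module R M]

theorem isUnit_mk_of_not_dvd {p : R} (hp : (Ideal.span {p}).IsMaximal) (n : ℕ)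
    (u : R ⧸ Ideal.span {p ^ n}) (hu : ¬ Ideal.Quotient.mk (Ideal.span {p ^ n}) p ∣ u) :
    IsUnit u := by
  obtain ⟨r, rfl⟩ := Ideal.Quotient.mk_surjective u
  have hr : r ∉ Ideal.span {p} := fun h =>
    hu (map_dvd _ (Ideal.mem_span_singleton.1 h))
  obtain ⟨s, t, ht, hst⟩ := hp.exists_inv hr
  obtain ⟨t, rfl⟩ := Ideal.mem_span_singleton.1 ht
  have hnil : IsNilpotent (Ideal.Quotient.mk (Ideal.span {p ^ n}) (p * t)) :=
    ⟨n, by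
      rw [← map_pow, Ideal.Quotient.eq_zero_iff_mem, mul_pow]
      exact Ideal.mul_mem_right _ _ (Ideal.mem_span_singleton_self _)⟩
  have h1 : Ideal.Quotient.mk (Ideal.span {p ^ n}) s * Ideal.Quotient.mk _ r =
      1 - Ideal.Quotient.mk _ (p * t) := by
    rw [← map_mul, ← map_one (Ideal.Quotient.mk _), ← map_sub, ← hst, add_sub_cancel_right]
  exact isUnit_of_mul_isUnit_right (h1 ▸ hnil.isUnit_one_sub)

theorem torsionBy_mul_fg [IsNoetherianRing R] {a b : R} (ha : (torsionBy R M a).FG)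
    (hb : (torsionBy R M b).FG) : (torsionBy R M (a * b)).FG := by
  refine fg_of_fg_map_of_fg_inf_ker (LinearMap.lsmul R M b) (hs1 := ?_) (hs2 := ?_)
  · have := isNoetherian_of_fg_of_noetherian _ ha
    refine FG.of_le ha ?_
    rintro _ ⟨x, hx, rfl⟩
    simpa [mul_smul] using hx
  · exact FG.of_le hb inf_le_right

theorem finite_of_torsionBy_fg [IsArtinianRing R] [IsPrincipalIdealRing R]
    (h : ∀ p : R, (Ideal.span {p}).IsMaximal → (torsionBy R M p).FG) : Module.Finite R M := by
  obtain ⟨Z, hZ⟩ := PrimeSpectrum.exists_primeSpectrum_prod_le R (⊥ : Ideal R)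
  have key : ∀ Z : Multiset (PrimeSpectrum R), ∃ a : R,
      (Z.map PrimeSpectrum.asIdeal).prod = Ideal.span {a} ∧ (torsionBy R M a).FG := by
    intro Z
    induction Z using Multiset.induction with
    | empty =>
      refine ⟨1, by simp, ?_⟩
      have : torsionBy R M (1 : R) = ⊥ := by ext; simp
      rw [this]
      exact fg_bot
    | cons P Z ih =>
      obtain ⟨a, ha, hfg⟩ := ih
      obtain ⟨p, hp⟩ := (IsPrincipalIdealRing.principal P.asIdeal).principal
      refine ⟨p * a, ?_, torsionBy_mul_fg (h p ?_) hfg⟩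
      · rw [Multiset.map_cons, Multiset.prod_cons, ha, hp]
        exact Ideal.span_singleton_mul_span_singleton _ _
      · have : P.asIdeal.IsMaximal := inferInstance
        rwa [hp] at this
  obtain ⟨a, ha, hfg⟩ := key Z
  have ha0 : a = 0 := by
    rw [ha, le_bot_iff, Ideal.span_singleton_eq_bot] at hZ
    exact hZ
  have : torsionBy R M (0 : R) = ⊤ := by ext; simp
  rw [ha0, this] at hfg
  exact ⟨hfg⟩

theorem torsionBy_le_range_of_isEssentialMono {E : Type*} [AddCommGroup E] [Module R E]
    {i : M →ₗ[R] E} (hi : IsEssentialMono i) {p : R} (hp : (Ideal.span {p}).IsMaximal) :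
    torsionBy R E p ≤ LinearMap.range i := by
  intro x hx
  by_cases hx0 : x = 0
  · rw [hx0]; exact zero_mem _
  obtain ⟨y, hy, hy0⟩ := (Submodule.ne_bot_iff _).1
    (hi.2 (R ∙ x) (by rwa [Ne, span_singleton_eq_bot]))
  obtain ⟨hyx, hym⟩ := hy
  obtain ⟨r, rfl⟩ := mem_span_singleton.1 hyx
  rw [mem_torsionBy_iff] at hx
  have hr : r ∉ Ideal.span {p} := by
    intro h
    obtain ⟨t, rfl⟩ := Ideal.mem_span_singleton'.1 h
    exact hy0 (by rw [mul_smul, hx, smul_zero])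
  obtain ⟨s, t, ht, hst⟩ := hp.exists_inv hr
  obtain ⟨t, rfl⟩ := Ideal.mem_span_singleton'.1 ht
  have : x = s • r • x := by
    conv_lhs => rw [← one_smul R x, ← hst, add_smul, mul_smul, mul_smul, hx, smul_zero, add_zero]
  rw [this]
  exact Submodule.smul_mem _ _ hym

/-- The image in `M / p ^ (k + 1) M` of the `p`-torsion elements of `p ^ k M`. -/
def ulmSubmodule (M : Type*) [AddCommGroup M] [Module R M] (p : R) (k : ℕ) :
    Submodule R (M ⧸ (Ideal.span {p ^ (k + 1)} • ⊤ : Submodule R M)) :=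
  (torsionBy R M p ⊓ LinearMap.range (LinearMap.lsmul R M (p ^ k))).map (mkQ _)

-- The filtration reaches zero at `n`, where `p ^ n = p ^ (n + 1) * r`; induction climbs back from
-- there.
theorem torsionBy_fg_of_ulmSubmodule_fg [IsArtinianRing R] {p : R}
    (h : ∀ k, (ulmSubmodule M p k).FG) : (torsionBy R M p).FG := by
  obtain ⟨n, r, hn⟩ : ∃ n : ℕ, ∃ r : R, p ^ n = p ^ (n + 1) * r := by
    obtain ⟨n, y, hy⟩ := IsArtinian.exists_pow_succ_smul_dvd p (1 : R)
    exact ⟨n, y, by simpa [smul_eq_mul] using hy.symm⟩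
  have key : ∀ j, (torsionBy R M p ⊓ LinearMap.range (LinearMap.lsmul R M (p ^ (n - j)))).FG := by
    intro j
    induction j with
    | zero =>
      convert fg_bot
      rw [eq_bot_iff]
      rintro _ ⟨hx, y, rfl⟩
      have hx : p • p ^ n • y = 0 := hx
      change p ^ n • y = 0
      rw [hn, mul_comm, mul_smul, pow_succ', mul_smul, hx, smul_zero]
    | succ j ih =>
      by_cases hj : j < n
      · refine fg_of_fg_map_of_fg_inf_ker (mkQ _) (hs1 := h (n - (j + 1))) (hs2 := ?_)
        have e : n - (j + 1) + 1 = n - j := by omega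
        refine (congrArg FG ?_).mpr ih
        rw [ker_mkQ, e, ideal_span_singleton_smul]
        ext x
        constructor
        · rintro ⟨⟨h1, -⟩, y, -, rfl⟩
          exact ⟨h1, y, rfl⟩
        · rintro ⟨h1, y, rfl⟩
          refine ⟨⟨h1, p • y, ?_⟩, y, trivial, rfl⟩
          simp only [LinearMap.lsmul_apply, ← mul_smul, ← pow_succ, e]
      · have e : n - (j + 1) = n - j := by omega
        rw [e]; exact ih
  have := key n
  rwa [Nat.sub_self, pow_zero, show LinearMap.range (LinearMap.lsmul R M 1) = ⊤ from
    LinearMap.range_eq_top.2 fun x => ⟨x, by simp⟩, inf_top_eq] at this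

/-- If the `k`-th Ulm submodule is not finitely generated, then `M` contains as a retract a
direct sum of infinitely many copies of `R / (p ^ (k + 1))`. -/
theorem exists_infinite_retract [IsPrincipalIdealRing R] {p : R}
    (hp : (Ideal.span {p}).IsMaximal) {k : ℕ} (h : ¬ (ulmSubmodule M p k).FG) :
    ∃ (ι : Set (ulmSubmodule M p k)) (_ : Infinite ι) (_ : Nontrivial (R ⧸ Ideal.span {p ^ (k + 1)}))
      (σ : (ι →₀ R ⧸ Ideal.span {p ^ (k + 1)}) →ₗ[R] M)
      (ρ : M →ₗ[R] (ι →₀ R ⧸ Ideal.span {p ^ (k + 1)})), ∀ x, ρ (σ x) = x := by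
  set I := Ideal.span {p ^ (k + 1)} with hI
  set W := ulmSubmodule M p k with hW
  have htors : Module.IsTorsionBySet R W (Ideal.span {p} : Ideal R) := by
    rw [Module.isTorsionBySet_span_singleton_iff]
    rintro ⟨_, x, hx, rfl⟩
    have hx : p • x = 0 := hx.1
    ext
    change p • mkQ _ x = 0
    rw [← map_smul, hx, map_zero]
  let : Field (R ⧸ Ideal.span {p}) := Ideal.Quotient.field _
  let : Module (R ⧸ Ideal.span {p}) W := htors.module
  have : IsScalarTower R (R ⧸ Ideal.span {p}) W := htors.isScalarTower
  let b := Module.Basis.ofVectorSpace (R ⧸ Ideal.span {p}) W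
  have hinf : Infinite (Module.Basis.ofVectorSpaceIndex (R ⧸ Ideal.span {p}) W) := by
    by_contra hfin
    rw [not_infinite_iff_finite] at hfin
    have : Module.Finite (R ⧸ Ideal.span {p}) W := Module.Finite.of_basis b
    have : Module.Finite R W := Module.Finite.trans (R ⧸ Ideal.span {p}) W
    exact h (Module.Finite.iff_fg.1 this)
  have hy : ∀ i, ∃ y : M, p • p ^ k • y = 0 ∧ mkQ (I • ⊤) (p ^ k • y) = (b i).1 := by
    intro i
    obtain ⟨_, ⟨hx, y, rfl⟩, hxi⟩ := (b i).2
    exact ⟨y, hx, hxi⟩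
  choose y hy0 hyb using hy
  have hyI : ∀ i, p ^ (k + 1) • y i = 0 := fun i => by rw [pow_succ', mul_smul, hy0]
  set π : R ⧸ I := Ideal.Quotient.mk I p with hπ
  have hu : ∀ u, ¬ π ∣ u → IsUnit u := isUnit_mk_of_not_dvd hp (k + 1)
  have hk1 : π ^ (k + 1) = 0 := by
    rw [hπ, ← map_pow, Ideal.Quotient.eq_zero_iff_mem]
    exact Ideal.mem_span_singleton_self _
  have hk : π ^ k ≠ 0 := by
    intro h0
    rw [hπ, ← map_pow, Ideal.Quotient.eq_zero_iff_mem] at h0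
    obtain ⟨r, hr⟩ := Ideal.mem_span_singleton'.1 h0
    obtain ⟨i⟩ : Nonempty (Module.Basis.ofVectorSpaceIndex (R ⧸ Ideal.span {p}) W) := inferInstance
    refine b.ne_zero i (Subtype.ext ?_)
    rw [← hyb i, ← hr, mul_smul, hyI, smul_zero, map_zero]
    rfl
  have hnt : Nontrivial (R ⧸ I) := ⟨⟨_, _, hk⟩⟩
  have : IsPrincipalIdealRing (R ⧸ I) :=
    IsPrincipalIdealRing.of_surjective (Ideal.Quotient.mk I) Ideal.Quotient.mk_surjective
  -- Multiplying by `p ^ k` turns a relation among the `y i` into one among the `b i`, so `p`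
  -- divides its coefficients.
  have hlin : LinearIndependent (R ⧸ I) fun i => mkQ (I • ⊤ : Submodule R M) (y i) := by
    refine linearIndependent_of_pow_smul hu hk hk1 _ fun c hc => ?_
    obtain ⟨r, rfl⟩ := Finsupp.mapRange_surjective (Ideal.Quotient.mk I) (map_zero _)
      Ideal.Quotient.mk_surjective c
    have hsum : Finsupp.linearCombination (R ⧸ Ideal.span {p}) b
        (r.mapRange (Ideal.Quotient.mk _) (map_zero _)) = 0 := by
      rw [Finsupp.linearCombination_apply, Finsupp.sum_mapRange_index (by simp)]
      rw [map_smul, Finsupp.linearCombination_apply,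
        Finsupp.sum_mapRange_index (by simp), Finsupp.smul_sum] at hc
      refine Subtype.ext ?_
      rw [Finsupp.sum, AddSubmonoidClass.coe_finsetSum]
      refine Eq.trans (Finset.sum_congr rfl fun i _ => ?_) hc
      change r i • (b i : M ⧸ (I • ⊤ : Submodule R M)) = p ^ k • r i • mkQ _ (y i)
      rw [← hyb i, map_smul, smul_comm]
    have hr := linearIndependent_iff.1 b.linearIndependent _ hsum
    ext i
    have hi := DFunLike.congr_fun hr i
    simp only [Finsupp.mapRange_apply, Finsupp.coe_zero, Pi.zero_apply,
      Ideal.Quotient.eq_zero_iff_mem] at hi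
    obtain ⟨t, ht⟩ := Ideal.mem_span_singleton.1 hi
    simp only [Finsupp.smul_apply, Finsupp.mapRange_apply, smul_eq_mul, ht, map_mul,
      Finsupp.coe_zero, Pi.zero_apply]
    rw [← mul_assoc, ← hπ, ← pow_succ, hk1, zero_mul]
  -- The retraction lives on `M / p ^ (k + 1) M`; the section reaches `M` itself because `p ^ (k +
  -- 1)` kills each `y i`.
  obtain ⟨ρ, hρ⟩ := exists_retraction_of_linearIndependent hu hk hk1 hlin
  let τ : ∀ i, (R ⧸ I) →ₗ[R] M := fun i =>
    liftQ I (LinearMap.toSpanSingleton R M (y i)) (by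
      rw [hI, Ideal.span, span_singleton_le_iff_mem]
      exact hyI i)
  have hτ : ∀ i r, τ i (Ideal.Quotient.mk I r) = r • y i := fun i r => rfl
  refine ⟨_, hinf, hnt, Finsupp.lsum R τ, ρ.restrictScalars R ∘ₗ mkQ _, fun x => ?_⟩
  induction x using Finsupp.induction_linear with
  | zero => simp
  | add f g hf hg => rw [map_add, map_add, hf, hg]
  | single i a =>
    obtain ⟨r, rfl⟩ := Ideal.Quotient.mk_surjective a
    rw [Finsupp.lsum_single, hτ, map_smul]
    change r • ρ (mkQ _ (y i)) = _
    rw [hρ, Finsupp.smul_single]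
    congr 1
    rw [← map_one (Ideal.Quotient.mk I)]
    change Ideal.Quotient.mk I (r * 1) = _
    rw [mul_one]

theorem finite_of_isCoHopfianModule [IsArtinianRing R] [IsPrincipalIdealRing R]
    (h : IsCoHopfianModule R M) : Module.Finite R M := by
  refine finite_of_torsionBy_fg fun p hp => torsionBy_fg_of_ulmSubmodule_fg fun k => ?_
  by_contra hfg
  obtain ⟨ι, _, _, σ, ρ, hρσ⟩ := exists_infinite_retract hp hfg
  exact not_isCoHopfianModule_finsupp (h.of_retract σ ρ hρσ)

theorem isBiHopfianModule_iff_finite [IsArtinianRing R] [IsPrincipalIdealRing R] :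
    IsBiHopfianModule R M ↔ Module.Finite R M :=
  ⟨fun h => finite_of_isCoHopfianModule h.2, fun _ => isBiHopfianModule_of_finite⟩

theorem IsEssentialMono.finite_iff [IsArtinianRing R] [IsPrincipalIdealRing R]
    {E : Type*} [AddCommGroup E] [Module R E] {i : M →ₗ[R] E} (hi : IsEssentialMono i) :
    Module.Finite R M ↔ Module.Finite R E := by
  refine ⟨fun _ => finite_of_torsionBy_fg fun p hp => ?_, fun _ => Module.Finite.of_injective i hi.1⟩
  exact FG.of_le (Module.Finite.iff_fg.1 inferInstance)
    (torsionBy_le_range_of_isEssentialMono hi hp)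

end Torsion

theorem theorem3p9 (R : Type u) [CommRing R] [IsArtinianRing R] [IsPrincipalIdealRing R]
    (M : Type v) [AddCommGroup M] [Module R M] :
    (IsBiHopfianModule R M ↔ Module.Finite R M) ∧
    (∀ [Small.{w} R] (E : Type w) [AddCommGroup E] [Module R E] (i : M →ₗ[R] E),
      IsInjectiveEnvelope i → (IsBiHopfianModule R M ↔ IsBiHopfianModule R E)) := by

  refine ⟨isBiHopfianModule_iff_finite, fun E _ _ i hi => ?_⟩
  rw [isBiHopfianModule_iff_finite, isBiHopfianModule_iff_finite]
  exact hi.essential.finite_iff
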